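/- Let $G$ be a Polish group. A $G$-flow is a compact Hausdorff space with a continuous left action of $G$; it is minimal if it is nonempty and every orbit is dense, and proximal if for all points $x,y$ there is a net $(g_\lambda)$ in $G$ with $\lim_\lambda g_\lambda x=\lim_\lambda g_\lambda y$. Let $\Pi(G)$ be the universal minimal proximal flow of $G$, that is, the (up to isomorphism unique) minimal proximal $G$-flow that maps by a continuous $G$-equivariant surjection onto every minimal proximal $G$-flow. An affine $G$-flow is a nonempty compact convex subset $K$ of a Hausdorff locally convex real topological vector space together with a continuous action of $G$ on $K$ by affine homeomorphisms; an affine subflow is a nonempty $G$-invariant compact convex subset; an affine extension $\phi\colon L\to K$ of affine $G$-flows is a continuous, affine, $G$-equivariant surjection. An affine extension $\phi\colon L\to K$ is proximally irreducible if the only affine subflow $C\subseteq L$ such that $$C\cap \operatorname{conv}\bigl(\overline{\operatorname{ext}}(L)\cap\phi^{-1}(\{y\})\bigr)\neq\emptyset\quad\text{for all } y\in\overline{\operatorname{ext}}(K)$$ is $C=L$, where $\overline{\operatorname{ext}}$ denotes the closure of the set of extreme points. An affine $G$-flow $K$ is proximally irreducible if every proximally irreducible extension $\phi\colon L\to K$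 is an isomorphism (a homeomorphism). For a $G$-flow $X$, let $P(X)$ be the set of regular Borel probability measures on $X$, viewed as a subset of $C(X)^*$ with the weak-$*$ topology, with $G$ acting by push-forward. Then $P(\Pi(G))$ is a proximally irreducible affine $G$-flow. -/

import Mathlib

open Set Filter Topology MeasureTheory

universe u v w

/-! Throughout, a `G`-flow is a compact Hausdorff space `X` with a continuous action of `G`, i.e.
`[TopologicalSpace X] [CompactSpace X] [T2Space X] [MulAction G X] [ContinuousSMul G X]`. -/

section Flows

variable (G : Type u) [Group G]

/-- A minimal flow: nonempty, and every orbit is dense. -/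
structure IsMinimalFlow (X : Type v) [TopologicalSpace X] [MulAction G X] : Prop where
  nonempty : Nonempty X
  minimal : MulAction.IsMinimal G X

/-- A proximal flow: for all `x, y` there is a net `g_i` in `G` (here: a filter on `G`) along which
`g_i x` and `g_i y` converge to the same point. -/
def IsProximalFlow (X : Type v) [TopologicalSpace X] [MulAction G X] : Prop :=
  ∀ x y : X, ∃ (F : Filter G) (z : X), F.NeBot ∧
    Tendsto (fun g : G => g • x) F (𝓝 z) ∧ Tendsto (fun g : G => g • y) F (𝓝 z)

/-- An extension of flows: a continuous equivariant surjection. -/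
structure IsFlowExtension {X : Type v} {Y : Type w} [TopologicalSpace X] [MulAction G X]
    [TopologicalSpace Y] [MulAction G Y] (φ : X → Y) : Prop where
  continuous : Continuous φ
  map_smul : ∀ (g : G) (x : X), φ (g • x) = g • φ x
  surjective : Function.Surjective φ

/-- The universal property of `Π(G)`: a minimal proximal flow which is an extension of every
minimal proximal flow. -/
structure IsUniversalMinimalProximalFlow (X : Type v) [TopologicalSpace X] [CompactSpace X]
    [T2Space X] [TopologicalSpace G] [MulAction G X] [ContinuousSMul G X] : Prop where
  minimal : IsMinimalFlow G X
  proximal : IsProximalFlow G X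
  universal : ∀ (Y : Type w) [TopologicalSpace Y] [CompactSpace Y] [T2Space Y] [MulAction G Y]
    [ContinuousSMul G Y], IsMinimalFlow G Y → IsProximalFlow G Y →
      ∃ φ : X → Y, IsFlowExtension G φ

/-- A nonempty closed invariant set. -/
structure IsSubflow {X : Type v} [TopologicalSpace X] [MulAction G X] (M : Set X) : Prop where
  closed : IsClosed M
  nonempty : M.Nonempty
  smul_mem : ∀ (g : G) (x : X), x ∈ M → g • x ∈ M

theorem exists_minimal_subflow (X : Type v) [TopologicalSpace X] [CompactSpace X] [Nonempty X]
    [MulAction G X] : ∃ M : Set X, IsSubflow G M ∧ ∀ N, IsSubflow G N → N ⊆ M → N = M := by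
  obtain ⟨M, -, hM⟩ := zorn_superset_nonempty {M : Set X | IsSubflow G M}
    (fun c hc hchain hne => by
      refine ⟨⋂₀ c, ⟨isClosed_sInter fun s hs => (hc hs).closed, ?_, ?_⟩,
        fun s hs => sInter_subset_of_mem hs⟩
      · have : Nonempty c := hne.to_subtype
        exact IsCompact.nonempty_sInter_of_directed_nonempty_isCompact_isClosed
          (fun a ha b hb => (hchain.total ha hb).elim
            (fun h => ⟨a, ha, subset_rfl, h⟩) (fun h => ⟨b, hb, h, subset_rfl⟩)) (fun s hs => (hc hs).nonempty)
          (fun s hs => (hc hs).closed.isCompact) (fun s hs => (hc hs).closed)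
      · intro g x hx s hs
        exact (hc hs).smul_mem g x (hx s hs))
    univ ⟨isClosed_univ, univ_nonempty, fun _ _ _ => trivial⟩
  exact ⟨M, hM.prop, fun N hN hNM => hM.eq_of_subset hN hNM⟩

variable {G}

theorem IsMinimalFlow.eq_univ {X : Type v} [TopologicalSpace X] [MulAction G X]
    (hX : IsMinimalFlow G X) {N : Set X} (hN : IsSubflow G N) : N = univ := by
  have := hX.minimal
  refine (eq_empty_or_univ_of_smul_invariant_closed G hN.closed ?_).resolve_left
    hN.nonempty.ne_empty
  rintro g _ ⟨x, hx, rfl⟩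
  exact hN.smul_mem g x hx

theorem IsMinimalFlow.of_subflows {X : Type v} [TopologicalSpace X] [MulAction G X]
    [ContinuousConstSMul G X] [Nonempty X] (h : ∀ N : Set X, IsSubflow G N → N = univ) :
    IsMinimalFlow G X := by
  refine ⟨inferInstance, (isMinimal_iff_isClosed_smul_invariant G).2 fun s hs hinv => ?_⟩
  rcases s.eq_empty_or_nonempty with he | hne
  · exact Or.inl he
  · exact Or.inr (h s ⟨hs, hne, fun g x hx => hinv g ⟨x, hx, rfl⟩⟩)

/-- An equivariant continuous map to a minimal flow is surjective. -/
theorem IsMinimalFlow.surjective {X : Type v} {Y : Type w} [TopologicalSpace X] [CompactSpace X]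
    [Nonempty X] [MulAction G X] [TopologicalSpace Y] [T2Space Y] [MulAction G Y]
    (hY : IsMinimalFlow G Y) {φ : X → Y} (hc : Continuous φ)
    (hs : ∀ (g : G) (x : X), φ (g • x) = g • φ x) : Function.Surjective φ := by
  rw [← range_eq_univ]
  refine hY.eq_univ ⟨(isCompact_range hc).isClosed, range_nonempty φ, ?_⟩
  rintro g _ ⟨x, rfl⟩
  exact ⟨g • x, hs g x⟩

variable (G) [TopologicalSpace G]

/-! ### Construction of the universal minimal proximal flow

Every minimal flow has at most `2 ^ (2 ^ |G|)` points, hence is isomorphic to one whose underlying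
set consists of families of subsets of `G`. `Π(G)` is a minimal subflow of the product of all
minimal proximal flows of this kind. -/

/-- A minimal proximal flow whose underlying set is a set of families of subsets of `G`. -/
structure MinProxModel : Type u where
  carrier : Set (Set (Set G))
  [top : TopologicalSpace carrier]
  [compact : CompactSpace carrier]
  [t2 : T2Space carrier]
  [act : MulAction G carrier]
  [cont : ContinuousSMul G carrier]
  minimal : IsMinimalFlow G carrier
  proximal : IsProximalFlow G carrier

attribute [instance] MinProxModel.top MinProxModel.compact MinProxModel.t2 MinProxModel.act
  MinProxModel.cont

/-- The product of all minimal proximal flows. -/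
abbrev MinProxProduct : Type u := ∀ i : MinProxModel G, i.carrier

instance : Nonempty (MinProxProduct G) := ⟨fun i => (i.minimal.nonempty).some⟩

/-- A minimal subflow of the product of all minimal proximal flows. -/
noncomputable def minProxSubflow : Set (MinProxProduct G) :=
  (exists_minimal_subflow G (MinProxProduct G)).choose

theorem minProxSubflow_isSubflow : IsSubflow G (minProxSubflow G) :=
  (exists_minimal_subflow G (MinProxProduct G)).choose_spec.1

theorem minProxSubflow_minimal (N : Set (MinProxProduct G)) (hN : IsSubflow G N)
    (h : N ⊆ minProxSubflow G) : N = minProxSubflow G :=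
  (exists_minimal_subflow G (MinProxProduct G)).choose_spec.2 N hN h

/-- The universal minimal proximal flow `Π(G)`. -/
def UMPF : Type u := minProxSubflow G

instance : TopologicalSpace (UMPF G) := inferInstanceAs (TopologicalSpace (minProxSubflow G))

instance : CompactSpace (UMPF G) :=
  isCompact_iff_compactSpace.1 (minProxSubflow_isSubflow G).closed.isCompact

instance : T2Space (UMPF G) := inferInstanceAs (T2Space (minProxSubflow G))

instance : MulAction G (UMPF G) where
  smul g x := ⟨g • x.1, (minProxSubflow_isSubflow G).smul_mem g x.1 x.2⟩
  one_smul x := Subtype.ext (one_smul G x.1)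
  mul_smul g h x := Subtype.ext (mul_smul g h x.1)

instance : ContinuousSMul G (UMPF G) where
  continuous_smul := Continuous.subtype_mk
    (continuous_fst.smul (continuous_subtype_val.comp continuous_snd)) _

variable {G}

theorem MinProxProduct.isProximalFlow : IsProximalFlow G (MinProxProduct G) := by
  intro x y
  -- a minimal subflow of the orbit closure of `(x, y)`
  let Z := MinProxProduct G
  let O : Set (Z × Z) := closure (MulAction.orbit G (x, y))
  have hO : IsSubflow G O := by
    refine ⟨isClosed_closure, (MulAction.nonempty_orbit _).closure, fun g p hp => ?_⟩
    exact smul_closure_orbit_subset g (x, y) ⟨p, hp, rfl⟩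
  have : CompactSpace O := isCompact_iff_compactSpace.1 hO.closed.isCompact
  have : Nonempty O := hO.nonempty.to_subtype
  let _ : MulAction G O :=
    { smul := fun g p => ⟨g • p.1, hO.smul_mem g p.1 p.2⟩
      one_smul := fun p => Subtype.ext (one_smul G p.1)
      mul_smul := fun g h p => Subtype.ext (mul_smul g h p.1) }
  have hval : ∀ (g : G) (p : O), ((g • p : O) : Z × Z) = g • (p : Z × Z) := fun _ _ => rfl
  obtain ⟨N, hN, hmin⟩ := exists_minimal_subflow G O
  have key : ∀ i : MinProxModel G, ∀ p ∈ N, (p : Z × Z).1 i = (p : Z × Z).2 i := by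
    intro i
    let N' : Set O := N ∩ {p | (p : Z × Z).1 i = (p : Z × Z).2 i}
    have hc1 : Continuous fun p : O => (p : Z × Z).1 i := by fun_prop
    have hc2 : Continuous fun p : O => (p : Z × Z).2 i := by fun_prop
    have hsub : IsSubflow G N' := by
      refine ⟨hN.closed.inter (isClosed_eq hc1 hc2), ?_, ?_⟩
      · obtain ⟨p, hp⟩ := hN.nonempty
        obtain ⟨F, z, hF, h1, h2⟩ := i.proximal ((p : Z × Z).1 i) ((p : Z × Z).2 i)
        let U : Ultrafilter G := Ultrafilter.of F
        have hU : (U : Filter G) ≤ F := Ultrafilter.of_le F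
        have hmem : ∀ᶠ q in ((U.map fun g => g • p : Ultrafilter O) : Filter O), q ∈ N :=
          Filter.Eventually.of_forall (f := (U : Filter G)) (p := fun g => g • p ∈ N)
            (fun g => hN.smul_mem g p hp)
        obtain ⟨q, hq, hlim⟩ :=
          hN.closed.isCompact.ultrafilter_le_nhds (U.map fun g => g • p) (le_principal_iff.2 hmem)
        have hlim' : Tendsto (fun g => g • p) (U : Filter G) (𝓝 q) := hlim
        have e1 : (q : Z × Z).1 i = z :=
          tendsto_nhds_unique ((hc1.tendsto q).comp hlim') (h1.mono_left hU)
        have e2 : (q : Z × Z).2 i = z :=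
          tendsto_nhds_unique ((hc2.tendsto q).comp hlim') (h2.mono_left hU)
        exact ⟨q, hq, e1.trans e2.symm⟩
      · rintro g p ⟨hp, he⟩
        refine ⟨hN.smul_mem g p hp, ?_⟩
        change g • (p : Z × Z).1 i = g • (p : Z × Z).2 i
        exact congrArg (g • ·) he
    have := hmin N' hsub inter_subset_left
    intro p hp
    rw [← this] at hp
    exact hp.2
  obtain ⟨p, hp⟩ := hN.nonempty
  have hdiag : (p : Z × Z).1 = (p : Z × Z).2 := funext fun i => key i p hp
  have hcl : (p : Z × Z) ∈ closure (range fun g : G => g • ((x, y) : Z × Z)) := p.2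
  refine ⟨comap (fun g : G => g • ((x, y) : Z × Z)) (𝓝 (p : Z × Z)), (p : Z × Z).1, ?_, ?_, ?_⟩
  · refine comap_neBot fun t ht => ?_
    obtain ⟨_, hq, g, rfl⟩ := mem_closure_iff_nhds.1 hcl t ht
    exact ⟨g, hq⟩
  · exact (continuous_fst.tendsto (p : Z × Z)).comp tendsto_comap
  · rw [hdiag]
    exact (continuous_snd.tendsto (p : Z × Z)).comp tendsto_comap

theorem UMPF.isMinimalFlow : IsMinimalFlow G (UMPF G) := by
  have : Nonempty (UMPF G) := (minProxSubflow_isSubflow G).nonempty.to_subtype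
  refine IsMinimalFlow.of_subflows fun N hN => ?_
  have hcl : IsClosed (minProxSubflow G) := (minProxSubflow_isSubflow G).closed
  have hsub : IsSubflow G (Subtype.val '' N : Set (MinProxProduct G)) := by
    refine ⟨hcl.isClosedMap_subtype_val N hN.closed, hN.nonempty.image _, ?_⟩
    rintro g _ ⟨(x : UMPF G), hx, rfl⟩
    exact ⟨(g • x : UMPF G), hN.smul_mem g x hx, rfl⟩
  have := minProxSubflow_minimal G _ hsub (by rintro _ ⟨x, _, rfl⟩; exact x.2)
  refine eq_univ_of_forall fun x => ?_
  have hx : x.1 ∈ (Subtype.val '' N : Set (MinProxProduct G)) := by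
    rw [this]
    exact x.2
  obtain ⟨y, hy, hyx⟩ := hx
  exact (Subtype.ext hyx : y = x) ▸ hy

theorem UMPF.isProximalFlow : IsProximalFlow G (UMPF G) := by
  intro x y
  obtain ⟨F, z, hF, h1, h2⟩ := MinProxProduct.isProximalFlow (G := G) x.1 y.1
  have hz : z ∈ minProxSubflow G :=
    (minProxSubflow_isSubflow G).closed.mem_of_tendsto h1
      (Eventually.of_forall fun g => (minProxSubflow_isSubflow G).smul_mem g x.1 x.2)
  exact ⟨F, ⟨z, hz⟩, hF, tendsto_subtype_rng.2 h1, tendsto_subtype_rng.2 h2⟩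

/-- Every minimal proximal flow is isomorphic to one in `MinProxModel G`. -/
theorem exists_minProxModel (Y : Type w) [TopologicalSpace Y] [CompactSpace Y] [T2Space Y]
    [MulAction G Y] [ContinuousSMul G Y] (hm : IsMinimalFlow G Y) (hp : IsProximalFlow G Y) :
    ∃ (i : MinProxModel G) (φ : i.carrier → Y), Continuous φ ∧
      ∀ (g : G) (x : i.carrier), φ (g • x) = g • φ x := by
  obtain ⟨y₀⟩ := hm.nonempty
  let j : Y → Set (Set G) := fun y => {A | y ∈ closure ((fun g : G => g • y₀) '' A)}
  have hj : Function.Injective j := by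
    intro a b hab
    by_contra hne
    obtain ⟨U, V, hU, hV, ha, hb, hUV⟩ := t2_separation hne
    have hA : {g : G | g • y₀ ∈ U} ∈ j a := by
      change a ∈ closure _
      rw [mem_closure_iff]
      intro W hW haW
      have := hm.minimal
      obtain ⟨g, hg⟩ := (hW.inter hU).exists_smul_mem G y₀ ⟨a, haW, ha⟩
      exact ⟨g • y₀, hg.1, g, hg.2, rfl⟩
    rw [hab] at hA
    obtain ⟨_, hzV, g, hg, rfl⟩ := mem_closure_iff.1 hA V hV hb
    exact disjoint_left.1 hUV hg hzV
  let e : Y ≃ range j := Equiv.ofInjective j hj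
  let _ : TopologicalSpace (range j) := TopologicalSpace.coinduced e inferInstance
  let h : Y ≃ₜ range j := e.toHomeomorph fun s => by
    rw [isOpen_coinduced]
  have _ : CompactSpace (range j) := h.compactSpace
  have _ : T2Space (range j) := h.t2Space
  let _ : MulAction G (range j) := e.symm.mulAction G
  have hsm : ∀ (g : G) (x : range j), h.symm (g • x) = g • h.symm x :=
    fun g x => e.symm_apply_apply _
  have hsm' : ∀ (g : G) (x : range j), g • x = h (g • h.symm x) := fun _ _ => rfl
  have _ : ContinuousSMul G (range j) := by
    refine ⟨?_⟩
    simp only [hsm']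
    fun_prop
  refine ⟨⟨range j, ⟨⟨h y₀⟩, ⟨fun x => ?_⟩⟩, fun x y => ?_⟩, h.symm, h.symm.continuous, hsm⟩
  · have := hm.minimal
    have hd : DenseRange fun g : G => h (g • h.symm x) :=
      h.surjective.denseRange.comp (denseRange_smul G (h.symm x)) h.continuous
    exact hd
  · obtain ⟨F, z, hF, h1, h2⟩ := hp (h.symm x) (h.symm y)
    exact ⟨F, h z, hF, (h.continuous.tendsto z).comp h1, (h.continuous.tendsto z).comp h2⟩

/-- `UMPF G` has the universal property of the universal minimal proximal flow, with respect to
minimal proximal flows in every universe. -/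
theorem UMPF.isUniversal : IsUniversalMinimalProximalFlow.{u, u, w} G (UMPF G) := by
  refine ⟨UMPF.isMinimalFlow, UMPF.isProximalFlow, fun Y _ _ _ _ _ hm hp => ?_⟩
  obtain ⟨i, φ, hc, hs⟩ := exists_minProxModel Y hm hp
  have hc' : Continuous fun x : UMPF G => φ (x.1 i) :=
    hc.comp ((continuous_apply i).comp continuous_subtype_val)
  have hs' : ∀ (g : G) (x : UMPF G), φ ((g • x).1 i) = g • φ (x.1 i) :=
    fun g x => hs g (x.1 i)
  have : Nonempty (UMPF G) := UMPF.isMinimalFlow.nonempty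
  exact ⟨fun x => φ (x.1 i), hc', hs', hm.surjective hc' hs'⟩

end Flows

section AffineFlows

variable (G : Type u) [Group G]

/-- An affine map between convex sets: it preserves convex combinations. -/
def IsAffineMap {E : Type v} {F : Type w} [AddCommGroup E] [Module ℝ E] [AddCommGroup F]
    [Module ℝ F] {K : Set E} {L : Set F} (φ : K → L) : Prop :=
  ∀ (x y z : K) (a b : ℝ), 0 ≤ a → 0 ≤ b → a + b = 1 →
    (z : E) = a • (x : E) + b • (y : E) → (φ z : F) = a • (φ x : F) + b • (φ y : F)

/-- An affine `G`-flow: a nonempty compact convex set in a Hausdorff locally convex space with a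
continuous action of `G` by affine maps (which are then affine homeomorphisms). -/
structure IsAffineFlow [TopologicalSpace G] {E : Type v} [AddCommGroup E] [Module ℝ E]
    [TopologicalSpace E] [IsTopologicalAddGroup E] [ContinuousSMul ℝ E] [LocallyConvexSpace ℝ E]
    [T2Space E] (K : Set E) [MulAction G K] : Prop where
  nonempty : K.Nonempty
  isCompact : IsCompact K
  convex : Convex ℝ K
  continuousSMul : ContinuousSMul G K
  affine : ∀ g : G, IsAffineMap fun x : K => g • x

/-- An affine subflow of `K`: a nonempty compact convex `G`-invariant subset. -/
structure IsAffineSubflow {E : Type v} [AddCommGroup E] [Module ℝ E] [TopologicalSpace E]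
    (K : Set E) [MulAction G K] (C : Set E) : Prop where
  nonempty : C.Nonempty
  subset : C ⊆ K
  isCompact : IsCompact C
  convex : Convex ℝ C
  smul_mem : ∀ (g : G) (x : K), (x : E) ∈ C → ((g • x : K) : E) ∈ C

/-- An affine extension: a continuous equivariant affine surjection. -/
structure IsAffineExtension {E : Type v} {F : Type w} [AddCommGroup E] [Module ℝ E]
    [TopologicalSpace E] [AddCommGroup F] [Module ℝ F] [TopologicalSpace F] {L : Set E}
    {K : Set F} [MulAction G L] [MulAction G K] (φ : L → K) : Prop
    extends IsFlowExtension G φ where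
  affine : IsAffineMap φ

/-- A proximally irreducible extension `φ : L → K`: the only affine subflow `C ⊆ L` that meets
`conv (cl (ext L) ∩ φ⁻¹{y})` for all `y ∈ cl (ext K)` is `L` itself. -/
structure IsProximallyIrreducibleExtension {E : Type v} {F : Type w} [AddCommGroup E] [Module ℝ E]
    [TopologicalSpace E] [AddCommGroup F] [Module ℝ F] [TopologicalSpace F] {L : Set E}
    {K : Set F} [MulAction G L] [MulAction G K] (φ : L → K) : Prop
    extends IsAffineExtension G φ where
  eq_of_meets : ∀ C : Set E, IsAffineSubflow G L C →
    (∀ y : K, (y : F) ∈ closure (K.extremePoints ℝ) →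
      (C ∩ convexHull ℝ
        (closure (L.extremePoints ℝ) ∩ Subtype.val '' (φ ⁻¹' {y}))).Nonempty) →
    C = L

/-- `K` is a proximally irreducible affine `G`-flow: it is an affine `G`-flow and each of its
proximally irreducible extensions (by affine flows `L` in arbitrary locally convex spaces) is an
isomorphism. -/
structure IsProximallyIrreducibleFlow [TopologicalSpace G] {F : Type v} [AddCommGroup F]
    [Module ℝ F] [TopologicalSpace F] [IsTopologicalAddGroup F] [ContinuousSMul ℝ F]
    [LocallyConvexSpace ℝ F] [T2Space F] (K : Set F) [MulAction G K] : Prop where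
  isAffineFlow : IsAffineFlow G K
  isHomeomorph : ∀ (E : Type w) [AddCommGroup E] [Module ℝ E] [TopologicalSpace E]
    [IsTopologicalAddGroup E] [ContinuousSMul ℝ E] [LocallyConvexSpace ℝ E] [T2Space E]
    (L : Set E) [MulAction G L], IsAffineFlow G L →
      ∀ φ : L → K, IsProximallyIrreducibleExtension G φ → IsHomeomorph φ

instance {V : Type v} [NormedAddCommGroup V] [NormedSpace ℝ V] :
    LocallyConvexSpace ℝ (WeakDual ℝ V) :=
  inferInstanceAs (LocallyConvexSpace ℝ (WeakBilin (topDualPairing ℝ V)))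

/-- `P(X)`: the regular Borel probability measures on a compact Hausdorff space `X`, viewed via
integration as elements of the dual of `C(X)` with the weak-* topology. -/
def probMeasures (X : Type v) [TopologicalSpace X] [CompactSpace X] [T2Space X] :
    Set (WeakDual ℝ C(X, ℝ)) :=
  let _ : MeasurableSpace X := borel X
  {Λ | ∃ μ : Measure X, IsProbabilityMeasure μ ∧ μ.Regular ∧ ∀ f : C(X, ℝ), Λ f = ∫ x, f x ∂μ}

/-- The translation `f ↦ f(g ·)` as a continuous linear map on `C(X)`. -/
noncomputable def compSmul {G : Type u} [Group G] (X : Type v) [TopologicalSpace X]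
    [CompactSpace X] [MulAction G X] [ContinuousConstSMul G X] (g : G) :
    C(X, ℝ) →L[ℝ] C(X, ℝ) where
  toFun f := f.comp ⟨fun x => g • x, continuous_const_smul g⟩
  map_add' _ _ := rfl
  map_smul' _ _ := rfl
  cont := ContinuousMap.continuous_precomp _

/-- The action of `G` on `P(X)` by push-forward, `∫ f d(gμ) = ∫ f(g x) dμ(x)`. -/
noncomputable instance probMeasures.mulAction (X : Type v) [TopologicalSpace X] [CompactSpace X]
    [T2Space X] [MulAction G X] [ContinuousConstSMul G X] : MulAction G (probMeasures X) where
  smul g Λ := ⟨StrongDual.toWeakDual ((WeakDual.toStrongDual Λ.1).comp (compSmul X g)), by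
    let _ : MeasurableSpace X := borel X
    have _ : BorelSpace X := ⟨rfl⟩
    obtain ⟨μ, hμ, hreg, h⟩ := Λ.2
    have hm : Measurable fun x : X => g • x := (continuous_const_smul g).measurable
    refine ⟨μ.map fun x => g • x, Measure.isProbabilityMeasure_map hm.aemeasurable,
      Measure.Regular.map (Homeomorph.smul g), fun f => ?_⟩
    rw [integral_map hm.aemeasurable f.continuous.aestronglyMeasurable]
    exact h (compSmul X g f)⟩
  one_smul Λ := by
    apply Subtype.ext
    apply DFunLike.ext
    intro f
    change Λ.1 (compSmul X (1 : G) f) = Λ.1 f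
    congr 1
    ext x
    exact congrArg f (one_smul G x)
  mul_smul g h Λ := by
    apply Subtype.ext
    apply DFunLike.ext
    intro f
    change Λ.1 (compSmul X (g * h) f) = Λ.1 (compSmul X h (compSmul X g f))
    congr 1
    ext x
    exact congrArg f (mul_smul g h x)

theorem probMeasures.smul_apply (X : Type v) [TopologicalSpace X] [CompactSpace X] [T2Space X]
    [MulAction G X] [ContinuousConstSMul G X] (g : G) (Λ : probMeasures X) (f : C(X, ℝ)) :
    (g • Λ).1 f = Λ.1 (f.comp ⟨fun x => g • x, continuous_const_smul g⟩) := rfl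

end AffineFlows

/-! Write `X` for `Π(G)` and let `φ : L → P(X)` be proximally irreducible. By Milman's theorem the
closed extreme boundary of `P(X)` consists of point masses. Irreducibility is used twice, each time
to show that a subflow of `L` has closed convex hull `L`. For a minimal subflow `M` of the points of
`cl (ext L)` over point masses, minimality of `X` makes `M` reach every fibre, so `M` generates `L`
(`IsProximallyIrreducibleExtension.exists_minimal`). For two points of `cl (ext L)` over one point
mass, the midpoints of the pairs in their orbit closure also generate `L`. By Milman, an extreme
point of `L` is such a midpoint, so its two ends coincide and the points are proximal
(`IsProximallyIrreducibleExtension.proximal_of_eq`). Proximality of `X` brings any two points of `M`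
into a common fibre in the limit, so `M` is minimal and proximal, and universality gives an
extension `ψ : X → M`. Rigidity of minimal proximal flows (`IsMinimalFlow.eq_of_proximal`) forces `φ
∘ ψ` to be `x ↦ δ_x`. Then `ℓ y = ∫ ℓ ∘ ψ d(φ y)` for every continuous functional `ℓ`, first on `M`
and by affinity on `L`; hence `φ` is injective, and by compactness a homeomorphism. -/

section Convexity

/-! ### Compact convex sets and Milman's theorem -/

variable {E : Type v} [AddCommGroup E] [Module ℝ E] [TopologicalSpace E]

/-- The join is a continuous image of `[0,1] × s × t`. It serves to make the join of two closed
hulls closed, so that it contains the closed hull of the union. -/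
theorem isCompact_convexJoin [ContinuousAdd E] [ContinuousSMul ℝ E] {s t : Set E}
    (hs : IsCompact s) (ht : IsCompact t) : IsCompact (convexJoin ℝ s t) := by
  have h : convexJoin ℝ s t = (fun p : ℝ × E × E => (1 - p.1) • p.2.1 + p.1 • p.2.2) ''
      (Icc (0 : ℝ) 1 ×ˢ s ×ˢ t) := by
    ext x
    simp only [mem_convexJoin, segment_eq_image, mem_image, Prod.exists, mem_prod]
    constructor
    · rintro ⟨a, ha, b, hb, θ, hθ, rfl⟩
      exact ⟨θ, a, b, ⟨hθ, ha, hb⟩, rfl⟩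
    · rintro ⟨θ, a, b, ⟨hθ, ha, hb⟩, rfl⟩
      exact ⟨a, ha, b, hb, θ, hθ, rfl⟩
  rw [h]
  exact (isCompact_Icc.prod (hs.prod ht)).image (by fun_prop)

/-- A closed convex condition on the values of a continuous affine map that holds on a set holds on
its closed convex hull. -/
theorem forall_mem_of_mem_closure_convexHull {F : Type w} [AddCommGroup F] [Module ℝ F]
    [TopologicalSpace F] [T2Space E] {L : Set E} (hL : IsCompact L) (hLc : Convex ℝ L) {f : L → F}
    (hf : Continuous f)
    (haff : ∀ (x y z : L) (a b : ℝ), 0 ≤ a → 0 ≤ b → a + b = 1 →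
      (z : E) = a • (x : E) + b • (y : E) → f z = a • f x + b • f y)
    {T : Set F} (hT : IsClosed T) (hTc : Convex ℝ T) {N : Set L} (hN : ∀ x ∈ N, f x ∈ T) (x : L)
    (hx : (x : E) ∈ closure (convexHull ℝ (Subtype.val '' N))) : f x ∈ T := by
  -- Since `f` lives only on `L`, its preimage of `T` is pushed into `E`, where it is a closed
  -- convex set containing `N`.
  have hcl : IsClosed (Subtype.val '' (f ⁻¹' T) : Set E) :=
    hL.isClosed.isClosedMap_subtype_val _ (hT.preimage hf)
  have hc : Convex ℝ (Subtype.val '' (f ⁻¹' T) : Set E) := by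
    rintro _ ⟨y, hy, rfl⟩ _ ⟨z, hz, rfl⟩ a b ha hb hab
    refine ⟨⟨_, hLc y.2 z.2 ha hb hab⟩, ?_, rfl⟩
    change f _ ∈ T
    rw [haff y z _ a b ha hb hab rfl]
    exact hTc hy hz ha hb hab
  obtain ⟨y, hy, hyx⟩ := closure_minimal (convexHull_min (image_mono hN) hc) hcl hx
  exact Subtype.ext hyx ▸ hy

variable [IsTopologicalAddGroup E] [ContinuousSMul ℝ E] [T2Space E]

/-- An extreme point of a compact convex set that lies in the closed convex hull of a union lies in
the closed convex hull of one of the two sets. -/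
theorem mem_closure_convexHull_of_union {K s t : Set E} (hK : IsCompact K) (hKc : Convex ℝ K)
    (hs : s ⊆ K) (ht : t ⊆ K) {e : E} (he : e ∈ K.extremePoints ℝ)
    (h : e ∈ closure (convexHull ℝ (s ∪ t))) :
    e ∈ closure (convexHull ℝ s) ∨ e ∈ closure (convexHull ℝ t) := by
  rcases s.eq_empty_or_nonempty with rfl | hs₀
  · exact Or.inr (by simpa using h)
  rcases t.eq_empty_or_nonempty with rfl | ht₀
  · exact Or.inl (by simpa using h)
  have hsK : closure (convexHull ℝ s) ⊆ K :=
    closure_minimal (convexHull_min hs hKc) hK.isClosed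
  have htK : closure (convexHull ℝ t) ⊆ K :=
    closure_minimal (convexHull_min ht hKc) hK.isClosed
  have hcomp := isCompact_convexJoin (hK.of_isClosed_subset isClosed_closure hsK)
    (hK.of_isClosed_subset isClosed_closure htK)
  have hsub : closure (convexHull ℝ (s ∪ t)) ⊆
      convexJoin ℝ (closure (convexHull ℝ s)) (closure (convexHull ℝ t)) := by
    refine closure_minimal ?_ hcomp.isClosed
    rw [convexHull_union hs₀ ht₀]
    exact convexJoin_mono subset_closure subset_closure
  obtain ⟨a, ha, b, hb, hab⟩ := mem_convexJoin.1 (hsub h)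
  rcases (mem_extremePoints_iff_forall_segment.1 he).2 a (hsK ha) b (htK hb) hab with rfl | rfl
  · exact Or.inl ha
  · exact Or.inr hb

variable [LocallyConvexSpace ℝ E]

/-- **Milman's theorem**: if `K` is the closed convex hull of `S` and both are compact, then the
extreme points of `K` lie in `S`. -/
theorem extremePoints_subset_of_closure_convexHull_eq {K S : Set E} (hK : IsCompact K)
    (hKc : Convex ℝ K) (hS : IsCompact S) (h : closure (convexHull ℝ S) = K) :
    K.extremePoints ℝ ⊆ S := by
  intro e he
  by_contra heS
  have hSK : S ⊆ K := h ▸ (subset_convexHull ℝ S).trans subset_closure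
  -- Compactness induction: the property passes to unions by the preceding lemma and holds near each
  -- point of `S`, so it holds for `S` itself, which contradicts `e ∈ K`.
  refine hS.induction_on (p := fun t => e ∉ closure (convexHull ℝ (t ∩ S))) (by simp)
    (fun s t hst ht hs => ht (closure_mono (convexHull_mono (inter_subset_inter_left S hst)) hs))
    (fun s t hs ht hst => ?_) (fun x hx => ?_) ?_
  · rw [union_inter_distrib_right] at hst
    exact (mem_closure_convexHull_of_union hK hKc (inter_subset_right.trans hSK)
      (inter_subset_right.trans hSK) he hst).elim hs ht
  · have hxe : x ≠ e := by rintro rfl; exact heS hx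
    obtain ⟨f, hf⟩ := geometric_hahn_banach_point_point hxe
    obtain ⟨c, hxc, hce⟩ := exists_between hf
    -- A closed half-space that is a neighbourhood of `x` and misses `e`; closed hulls of its
    -- subsets stay inside it.
    refine ⟨{y | f y ≤ c}, mem_nhdsWithin_of_mem_nhds ?_, fun hmem => ?_⟩
    · exact mem_of_superset ((isOpen_lt f.continuous continuous_const).mem_nhds hxc)
        fun y (hy : f y < c) => hy.le
    · have hsub : closure (convexHull ℝ ({y | f y ≤ c} ∩ S)) ⊆ {y | f y ≤ c} :=
        closure_minimal (convexHull_min inter_subset_left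
          (convex_halfSpace_le f.toLinearMap.isLinear c)) (isClosed_le f.continuous continuous_const)
      exact absurd (hsub hmem) (not_le.2 hce)
  · rw [inter_self, h]
    exact he.1

/-- A nonempty closed extreme subset of a compact set contains an extreme point of it. -/
theorem IsExtreme.exists_extremePoint {K F : Set E} (hK : IsCompact K) (hF : IsClosed F)
    (hne : F.Nonempty) (h : IsExtreme ℝ K F) : ∃ e ∈ F, e ∈ K.extremePoints ℝ := by
  obtain ⟨e, he⟩ := (hK.of_isClosed_subset hF h.1).extremePoints_nonempty hne
  exact ⟨e, he.1, h.extremePoints_subset_extremePoints he⟩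

end Convexity

/-! ### Affine subflows and extreme points under the action -/

section AffineFlows

variable {G : Type u} [Group G] [TopologicalSpace G] {E : Type v} [AddCommGroup E] [Module ℝ E]
  [TopologicalSpace E] [IsTopologicalAddGroup E] [ContinuousSMul ℝ E] [LocallyConvexSpace ℝ E]
  [T2Space E] {L : Set E} [MulAction G L]

theorem IsAffineFlow.closure_convexHull_subset (hL : IsAffineFlow G L) (N : Set L) :
    closure (convexHull ℝ (Subtype.val '' N)) ⊆ L :=
  closure_minimal (convexHull_min (Subtype.coe_image_subset L N) hL.convex) hL.isCompact.isClosed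

/-- The closed convex hull of a subflow is an affine subflow. -/
theorem IsAffineFlow.isAffineSubflow_closure_convexHull (hL : IsAffineFlow G L) {N : Set L}
    (hN : IsSubflow G N) :
    IsAffineSubflow G L (closure (convexHull ℝ (Subtype.val '' N))) where
  nonempty := (hN.nonempty.image _).convexHull.closure
  subset := hL.closure_convexHull_subset N
  isCompact := hL.isCompact.of_isClosed_subset isClosed_closure (hL.closure_convexHull_subset N)
  convex := (convex_convexHull ℝ _).closure
  smul_mem g x hx := by
    have := hL.continuousSMul
    exact forall_mem_of_mem_closure_convexHull hL.isCompact hL.convex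
      (f := fun y : L => ((g • y : L) : E)) (by fun_prop) (hL.affine g) isClosed_closure
      (convex_convexHull ℝ _).closure
      (fun y hy => subset_closure (subset_convexHull ℝ _ (mem_image_of_mem _ (hN.smul_mem g y hy)))) x hx

/-- The affine map `g⁻¹` carries an open segment through `g • x` to one through `x`. -/
theorem IsAffineFlow.smul_mem_extremePoints (hL : IsAffineFlow G L) (g : G) {x : L}
    (hx : (x : E) ∈ L.extremePoints ℝ) : ((g • x : L) : E) ∈ L.extremePoints ℝ := by
  refine ⟨(g • x).2, ?_⟩
  rintro y hy z hz ⟨a, b, ha, hb, hab, h⟩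
  have h' := hL.affine g⁻¹ ⟨y, hy⟩ ⟨z, hz⟩ (g • x) a b ha.le hb.le hab h.symm
  simp only [inv_smul_smul] at h'
  have := hx.2 (g⁻¹ • (⟨y, hy⟩ : L)).2 (g⁻¹ • (⟨z, hz⟩ : L)).2 ⟨a, b, ha, hb, hab, h'.symm⟩
  rw [← Subtype.ext this, smul_inv_smul]

theorem IsAffineFlow.smul_mem_closure_extremePoints (hL : IsAffineFlow G L) (g : G) {x : L}
    (hx : (x : E) ∈ closure (L.extremePoints ℝ)) :
    ((g • x : L) : E) ∈ closure (L.extremePoints ℝ) := by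
  have := hL.continuousSMul
  have hcl : IsClosed (Subtype.val ''
      {y : L | ((g • y : L) : E) ∈ closure (L.extremePoints ℝ)}) :=
    hL.isCompact.isClosed.isClosedMap_subtype_val _ (isClosed_closure.preimage (by fun_prop))
  have hsub : L.extremePoints ℝ ⊆ Subtype.val ''
      {y : L | ((g • y : L) : E) ∈ closure (L.extremePoints ℝ)} := fun y hy =>
    ⟨⟨y, hy.1⟩, subset_closure (hL.smul_mem_extremePoints g (x := ⟨y, hy.1⟩) hy), rfl⟩
  obtain ⟨y, hy, hyx⟩ := closure_minimal hsub hcl hx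
  exact Subtype.ext hyx ▸ hy

/-- Milman's theorem, in the form applied to the set of midpoints. -/
theorem IsAffineFlow.extremePoints_subset (hL : IsAffineFlow G L) {N : Set L}
    (hN : IsClosed N) (h : closure (convexHull ℝ (Subtype.val '' N)) = L) :
    L.extremePoints ℝ ⊆ Subtype.val '' N := by
  have : CompactSpace L := isCompact_iff_compactSpace.1 hL.isCompact
  exact extremePoints_subset_of_closure_convexHull_eq hL.isCompact hL.convex
    (hN.isCompact.image continuous_subtype_val) h

end AffineFlows

/-! ### The affine flow `P(X)` -/

section ProbMeasures

variable {X : Type v} [TopologicalSpace X] [CompactSpace X] [T2Space X]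

/-- **Riesz representation**: `P(X)` consists of the normalized positive functionals. -/
theorem mem_probMeasures_iff {Λ : WeakDual ℝ C(X, ℝ)} :
    Λ ∈ probMeasures X ↔ Λ 1 = 1 ∧ ∀ f : C(X, ℝ), 0 ≤ f → 0 ≤ Λ f := by
  let _ : MeasurableSpace X := borel X
  have _ : BorelSpace X := ⟨rfl⟩
  constructor
  · rintro ⟨μ, hμ, -, h⟩
    exact ⟨by simp [h], fun f hf => by rw [h]; exact integral_nonneg hf⟩
  · rintro ⟨h1, hpos⟩
    -- On a compact space every continuous function has compact support, so the
    -- Riesz–Markov–Kakutani theorem applies to all of `C(X)`.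
    let toC : CompactlySupportedContinuousMap X ℝ → C(X, ℝ) := fun f => f.toContinuousMap
    let Φ : CompactlySupportedContinuousMap X ℝ →ₚ[ℝ] ℝ :=
      { toFun := fun f => Λ (toC f)
        map_add' := fun f g => map_add Λ (toC f) (toC g)
        map_smul' := fun c f => map_smul Λ c (toC f)
        monotone' := fun f g hfg => by
          have := hpos (toC g - toC f) (sub_nonneg.2 hfg)
          rw [map_sub] at this
          exact sub_nonneg.1 this }
    have key : ∀ f : C(X, ℝ), Λ f = ∫ x, f x ∂(RealRMK.rieszMeasure Φ) := fun f =>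
      (RealRMK.integral_rieszMeasure Φ ⟨f, HasCompactSupport.of_compactSpace _⟩).symm
    refine ⟨RealRMK.rieszMeasure Φ, ⟨?_⟩, inferInstance, key⟩
    have := key 1
    rw [h1] at this
    simp only [ContinuousMap.one_apply, integral_const, smul_eq_mul, mul_one] at this
    rw [← ENNReal.toReal_eq_one_iff]
    exact this.symm

theorem le_of_forall_le_of_mem_probMeasures {Λ : WeakDual ℝ C(X, ℝ)} (hΛ : Λ ∈ probMeasures X)
    {f : C(X, ℝ)} {c : ℝ} (h : ∀ x, f x ≤ c) : Λ f ≤ c := by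
  obtain ⟨h1, hpos⟩ := mem_probMeasures_iff.1 hΛ
  have := hpos (c • 1 - f) (fun x => by simpa using h x)
  rw [map_sub, map_smul, h1] at this
  simpa using this

theorem abs_apply_le_of_mem_probMeasures {Λ : WeakDual ℝ C(X, ℝ)} (hΛ : Λ ∈ probMeasures X)
    (f : C(X, ℝ)) : |Λ f| ≤ ‖f‖ := by
  refine abs_le.2 ⟨neg_le.1 ?_, ?_⟩
  · rw [← map_neg]
    exact le_of_forall_le_of_mem_probMeasures hΛ fun x => (neg_le_abs _).trans (f.norm_coe_le_norm x)
  · exact le_of_forall_le_of_mem_probMeasures hΛ fun x => (le_abs_self _).trans (f.norm_coe_le_norm x)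

/-- Banach–Alaoglu: normalization and positivity are weak-* closed conditions that force norm at
most one. -/
theorem isCompact_probMeasures : IsCompact (probMeasures X) := by
  refine (WeakDual.isCompact_closedBall (0 : StrongDual ℝ C(X, ℝ)) 1).of_isClosed_subset ?_ ?_
  · have : probMeasures X = {Λ | Λ 1 = 1} ∩ ⋂ (f : C(X, ℝ)) (_ : 0 ≤ f), {Λ | 0 ≤ Λ f} := by
      ext Λ
      simp [mem_probMeasures_iff]
    rw [this]
    exact (isClosed_eq (WeakDual.eval_continuous _) continuous_const).inter
      (isClosed_iInter fun f => isClosed_iInter fun _ =>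
        isClosed_le continuous_const (WeakDual.eval_continuous f))
  · intro Λ hΛ
    rw [mem_preimage, mem_closedBall_zero_iff]
    exact ContinuousLinearMap.opNorm_le_bound _ zero_le_one fun f => by
      simpa using! abs_apply_le_of_mem_probMeasures hΛ f

theorem convex_probMeasures : Convex ℝ (probMeasures X) := by
  intro Λ hΛ Λ' hΛ' a b ha hb hab
  rw [mem_probMeasures_iff] at *
  refine ⟨?_, fun f hf => ?_⟩
  · change a * Λ 1 + b * Λ' 1 = 1
    rw [hΛ.1, hΛ'.1, mul_one, mul_one, hab]
  · exact add_nonneg (mul_nonneg ha (hΛ.2 f hf)) (mul_nonneg hb (hΛ'.2 f hf))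

/-- The point mass at `x`. -/
noncomputable def diracProb (x : X) : probMeasures X :=
  ⟨StrongDual.toWeakDual (ContinuousMap.evalCLM ℝ x),
    mem_probMeasures_iff.2 ⟨rfl, fun _ hf => hf x⟩⟩

theorem diracProb_apply (x : X) (f : C(X, ℝ)) : (diracProb x).1 f = f x := rfl

theorem continuous_diracProb : Continuous (diracProb : X → probMeasures X) :=
  Continuous.subtype_mk (WeakDual.continuous_of_continuous_eval fun f => f.continuous) _

theorem smul_diracProb {G : Type u} [Group G] [MulAction G X] [ContinuousConstSMul G X] (g : G)
    (x : X) : g • diracProb x = diracProb (g • x) := rfl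

/-- Hahn–Banach: weak-* continuous functionals are evaluations at some `f ∈ C(X)`, and a bound on
`f` at all points of `X` bounds its integral against every probability measure. -/
theorem closure_convexHull_diracProb :
    closure (convexHull ℝ (Subtype.val '' range (diracProb : X → probMeasures X))) =
      probMeasures X := by
  refine Subset.antisymm (closure_minimal (convexHull_min (Subtype.coe_image_subset _ _)
    convex_probMeasures) isCompact_probMeasures.isClosed) fun Λ hΛ => ?_
  by_contra hΛ'
  obtain ⟨ℓ, c, hc, hcΛ⟩ := geometric_hahn_banach_closed_point
    (convex_convexHull ℝ _).closure isClosed_closure hΛ'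
  obtain ⟨f, hf⟩ := LinearMap.dualEmbedding_surjective (topDualPairing ℝ C(X, ℝ)) ℓ
  have hf' : ∀ Λ : WeakDual ℝ C(X, ℝ), ℓ Λ = Λ f := fun Λ => by rw [← hf]; rfl
  rw [hf'] at hcΛ
  refine absurd (le_of_forall_le_of_mem_probMeasures hΛ fun x => ?_) (not_le.2 hcΛ)
  have := hc (diracProb x : WeakDual ℝ C(X, ℝ))
    (subset_closure (subset_convexHull ℝ _ ⟨_, mem_range_self x, rfl⟩))
  rw [hf'] at this
  exact this.le

/-- `P(X)` is an affine flow. -/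
theorem isAffineFlow_probMeasures (G : Type u) [Group G] [TopologicalSpace G] [Nonempty X]
    [MulAction G X] [ContinuousSMul G X] : IsAffineFlow G (probMeasures X) where
  nonempty := ⟨_, (diracProb (Classical.arbitrary X)).2⟩
  isCompact := isCompact_probMeasures
  convex := convex_probMeasures
  continuousSMul := by
    refine ⟨Continuous.subtype_mk (WeakDual.continuous_of_continuous_eval fun f => ?_) _⟩
    -- Joint continuity: `g ↦ f(g ·)` is norm continuous because `X` is compact, and `|Λ h| ≤ ‖h‖`
    -- uniformly in `Λ`, so replacing `T g` by `T g₀` costs little.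
    let T : G → C(X, ℝ) := fun g => compSmul X g f
    have hT : Continuous T :=
      ContinuousMap.continuous_of_continuous_uncurry T (f.continuous.comp continuous_smul)
    change Continuous fun p : G × probMeasures X => p.2.1 (T p.1)
    rw [continuous_iff_continuousAt]
    rintro ⟨g₀, Λ₀⟩
    have h1 : Tendsto (fun p : G × probMeasures X => p.2.1 (T p.1 - T g₀)) (𝓝 (g₀, Λ₀)) (𝓝 0) := by
      refine squeeze_zero_norm (fun p => abs_apply_le_of_mem_probMeasures p.2.2 _) ?_
      have : Continuous fun p : G × probMeasures X => ‖T p.1 - T g₀‖ := by fun_prop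
      simpa using this.tendsto (g₀, Λ₀)
    have h2 : Tendsto (fun p : G × probMeasures X => p.2.1 (T g₀)) (𝓝 (g₀, Λ₀))
        (𝓝 (Λ₀.1 (T g₀))) :=
      ((WeakDual.eval_continuous (T g₀)).comp
        (continuous_subtype_val.comp continuous_snd)).tendsto (g₀, Λ₀)
    have h3 := h1.add h2
    simp only [map_sub, sub_add_cancel, zero_add] at h3
    exact h3
  affine g Λ Λ' Λ'' a b _ _ _ h := by
    apply DFunLike.ext
    intro f
    exact DFunLike.congr_fun h (compSmul X g f)

end ProbMeasures

/-! ### Orbit closures, proximality and rigidity -/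

section Flows

variable {G : Type u} [Group G] {X : Type v} [TopologicalSpace X] [MulAction G X]

/-- Every subflow of a compact flow contains a minimal one. -/
theorem IsSubflow.exists_minimal [CompactSpace X] {Z : Set X} (hZ : IsSubflow G Z) :
    ∃ M ⊆ Z, IsSubflow G M ∧ ∀ N, IsSubflow G N → N ⊆ M → N = M := by
  obtain ⟨M, hMZ, hM⟩ := zorn_superset_nonempty {M : Set X | IsSubflow G M}
    (fun c hc hchain hne => by
      refine ⟨⋂₀ c, ⟨isClosed_sInter fun s hs => (hc hs).closed, ?_, fun g x hx s hs =>
        (hc hs).smul_mem g x (hx s hs)⟩, fun s hs => sInter_subset_of_mem hs⟩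
      have : Nonempty c := hne.to_subtype
      exact IsCompact.nonempty_sInter_of_directed_nonempty_isCompact_isClosed
        (fun a ha b hb => (hchain.total ha hb).elim (fun h => ⟨a, ha, subset_rfl, h⟩)
          (fun h => ⟨b, hb, h, subset_rfl⟩)) (fun s hs => (hc hs).nonempty)
        (fun s hs => (hc hs).closed.isCompact) (fun s hs => (hc hs).closed)) Z hZ
  exact ⟨M, hMZ, hM.prop, fun N hN hNM => hM.eq_of_subset hN hNM⟩

theorem isSubflow_closure_orbit [ContinuousConstSMul G X] (x : X) :
    IsSubflow G (closure (MulAction.orbit G x)) where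
  closed := isClosed_closure
  nonempty := (MulAction.nonempty_orbit x).closure
  smul_mem g y hy := smul_closure_orbit_subset g x ⟨y, hy, rfl⟩

theorem IsSubflow.closure_orbit_subset {M : Set X} (hM : IsSubflow G M) {x : X} (hx : x ∈ M) :
    closure (MulAction.orbit G x) ⊆ M :=
  closure_minimal (by rintro _ ⟨g, rfl⟩; exact hM.smul_mem g x hx) hM.closed

theorem mem_closure_orbit_self (x : X) : x ∈ closure (MulAction.orbit G x) :=
  subset_closure (MulAction.mem_orbit_self x)

/-- A net in `G` moves `x` and `y` to `z` iff `(z, z)` is in the orbit closure of `(x, y)`. -/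
theorem exists_tendsto_iff_mem_closure_orbit {x y z : X} :
    (∃ F : Filter G, F.NeBot ∧ Tendsto (fun g : G => g • x) F (𝓝 z) ∧
      Tendsto (fun g : G => g • y) F (𝓝 z)) ↔ (z, z) ∈ closure (MulAction.orbit G (x, y)) := by
  constructor
  · rintro ⟨F, hF, h1, h2⟩
    exact mem_closure_of_tendsto (h1.prodMk_nhds h2) (Eventually.of_forall fun g => ⟨g, rfl⟩)
  · intro hz
    refine ⟨comap (fun g : G => g • (x, y)) (𝓝 (z, z)), ?_, ?_, ?_⟩
    · refine comap_neBot fun t ht => ?_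
      obtain ⟨_, hq, g, rfl⟩ := mem_closure_iff_nhds.1 hz t ht
      exact ⟨g, hq⟩
    · exact (continuous_fst.tendsto (z, z)).comp tendsto_comap
    · exact (continuous_snd.tendsto (z, z)).comp tendsto_comap

/-- An equivariant continuous map of a minimal proximal flow into the image of another such map
coincides with it. -/
theorem IsMinimalFlow.eq_of_proximal (hm : IsMinimalFlow G X) (hp : IsProximalFlow G X)
    {Y : Type w} [TopologicalSpace Y] [T2Space Y] [MulAction G Y] {δ T : X → Y}
    (hδ : Continuous δ) (hδs : ∀ (g : G) (x : X), δ (g • x) = g • δ x)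
    (hT : Continuous T) (hTs : ∀ (g : G) (x : X), T (g • x) = g • T x)
    (hran : ∀ x, T x ∈ range δ) : T = δ := by
  obtain ⟨x₀⟩ := hm.nonempty
  -- With `T x₀ = δ x₁`, equivariance gives `T (g x₀) = δ (g x₁)` for all `g`. Moving `x₀` and `x₁`
  -- to a common limit `z` gives `T z = δ z`.
  obtain ⟨x₁, hx₁⟩ := hran x₀
  obtain ⟨F, z, hF, h0, h1⟩ := hp x₀ x₁
  have hz : T z = δ z := by
    refine tendsto_nhds_unique ((hT.tendsto z).comp h0) (((hδ.tendsto z).comp h1).congr fun g => ?_)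
    simp only [Function.comp, hδs, hTs, hx₁]
  have hsub : IsSubflow G {x | T x = δ x} :=
    ⟨isClosed_eq hT hδ, ⟨z, hz⟩, fun g x (hx : T x = δ x) => by
      change T _ = δ _
      rw [hδs, hTs, hx]⟩
  funext x
  exact eq_univ_iff_forall.1 (hm.eq_univ hsub) x

/-- The action on a subflow. -/
abbrev IsSubflow.mulAction {M : Set X} (hM : IsSubflow G M) : MulAction G M where
  smul g x := ⟨g • x.1, hM.smul_mem g x.1 x.2⟩
  one_smul x := Subtype.ext (one_smul G x.1)
  mul_smul g h x := Subtype.ext (mul_smul g h x.1)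

theorem IsSubflow.continuousSMul [TopologicalSpace G] [ContinuousSMul G X] {M : Set X}
    (hM : IsSubflow G M) :
    let _ : MulAction G M := hM.mulAction
    ContinuousSMul G M :=
  let _ : MulAction G M := hM.mulAction
  ⟨Continuous.subtype_mk
    (continuous_fst.smul (continuous_subtype_val.comp continuous_snd)) _⟩

theorem IsSubflow.isMinimalFlow [ContinuousConstSMul G X] {M : Set X} (hM : IsSubflow G M)
    (hmin : ∀ N, IsSubflow G N → N ⊆ M → N = M) :
    let _ : MulAction G M := hM.mulAction
    IsMinimalFlow G M := by
  intro _
  have : ContinuousConstSMul G M :=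
    ⟨fun g => Continuous.subtype_mk ((continuous_const_smul g).comp continuous_subtype_val) _⟩
  have : Nonempty M := hM.nonempty.to_subtype
  refine IsMinimalFlow.of_subflows fun N hN => ?_
  have hsub : IsSubflow G (Subtype.val '' N) := by
    refine ⟨hM.closed.isClosedMap_subtype_val N hN.closed, hN.nonempty.image _, ?_⟩
    rintro g _ ⟨x, hx, rfl⟩
    exact ⟨⟨g • x.1, hM.smul_mem g x.1 x.2⟩, hN.smul_mem g x hx, rfl⟩
  refine eq_univ_of_forall fun x => ?_
  have hx : (x : X) ∈ Subtype.val '' N := by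
    rw [hmin _ hsub (Subtype.coe_image_subset M N)]
    exact x.2
  obtain ⟨y, hy, hyx⟩ := hx
  exact Subtype.ext hyx ▸ hy

/-- The common limit automatically lies in `M`, since `M` is closed and invariant. -/
theorem IsSubflow.isProximalFlow {M : Set X} (hM : IsSubflow G M)
    (h : ∀ x ∈ M, ∀ y ∈ M, ∃ z, (z, z) ∈ closure (MulAction.orbit G (x, y))) :
    let _ : MulAction G M := hM.mulAction
    IsProximalFlow G M := by
  intro _ x y
  obtain ⟨z, hz⟩ := h x x.2 y y.2
  obtain ⟨F, hF, h1, h2⟩ := exists_tendsto_iff_mem_closure_orbit.2 hz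
  have hzM : z ∈ M :=
    hM.closed.mem_of_tendsto h1 (Eventually.of_forall fun g => hM.smul_mem g x.1 x.2)
  exact ⟨F, ⟨z, hzM⟩, hF, tendsto_subtype_rng.2 h1, tendsto_subtype_rng.2 h2⟩

end Flows

/-! ### Proximally irreducible extensions of `P(X)` -/

section Irreducible

variable {G : Type u} [Group G] [TopologicalSpace G] {X : Type v} [TopologicalSpace X]
  [CompactSpace X] [T2Space X] [MulAction G X] [ContinuousSMul G X]
  {E : Type w} [AddCommGroup E] [Module ℝ E] [TopologicalSpace E] [IsTopologicalAddGroup E]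
  [ContinuousSMul ℝ E] [LocallyConvexSpace ℝ E] [T2Space E] {L : Set E} [MulAction G L]
  {φ : L → probMeasures X}

/-- Milman's theorem for the compact generating set of point masses. Consequently the irreducibility
condition needs checking only over point masses. -/
theorem closure_extremePoints_probMeasures_subset :
    closure ((probMeasures X).extremePoints ℝ) ⊆
      Subtype.val '' range (diracProb : X → probMeasures X) := by
  have hc : IsCompact (Subtype.val '' range (diracProb : X → probMeasures X)) :=
    (isCompact_range continuous_diracProb).image continuous_subtype_val
  exact closure_minimal (extremePoints_subset_of_closure_convexHull_eq isCompact_probMeasures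
    convex_probMeasures hc closure_convexHull_diracProb) hc.isClosed

/-- The fibre of an affine extension over an extreme point contains an extreme point. -/
theorem IsAffineExtension.exists_extremePoint {F : Type v} [AddCommGroup F] [Module ℝ F]
    [TopologicalSpace F] [T2Space F] {K : Set F} [MulAction G K] {φ : L → K}
    (hL : IsAffineFlow G L) (hφ : IsAffineExtension G φ) {y : K} (hy : (y : F) ∈ K.extremePoints ℝ) :
    ∃ x : L, (x : E) ∈ L.extremePoints ℝ ∧ φ x = y := by
  have hcl : IsClosed (Subtype.val '' (φ ⁻¹' {y}) : Set E) :=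
    hL.isCompact.isClosed.isClosedMap_subtype_val _ (isClosed_singleton.preimage hφ.continuous)
  have hne : (Subtype.val '' (φ ⁻¹' {y}) : Set E).Nonempty := by
    obtain ⟨x, hx⟩ := hφ.surjective y
    exact ⟨x, x, hx, rfl⟩
  -- The fibre is a face: if a proper convex combination of two points maps to the extreme point
  -- `y`, so do both points.
  have hext : IsExtreme ℝ L (Subtype.val '' (φ ⁻¹' {y})) := by
    refine ⟨Subtype.coe_image_subset _ _, ?_⟩
    rintro a ha b hb _ ⟨x, hx, rfl⟩ ⟨s, t, hs, ht, hst, h⟩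
    have h' := hφ.affine ⟨a, ha⟩ ⟨b, hb⟩ x s t hs.le ht.le hst h.symm
    rw [mem_preimage, mem_singleton_iff] at hx
    rw [hx] at h'
    have := hy.2 (φ ⟨a, ha⟩).2 (φ ⟨b, hb⟩).2 ⟨s, t, hs, ht, hst, h'.symm⟩
    exact ⟨⟨a, ha⟩, Subtype.ext this, rfl⟩
  obtain ⟨_, ⟨x, hx, rfl⟩, he⟩ := IsExtreme.exists_extremePoint hL.isCompact hcl hne hext
  exact ⟨x, he, hx⟩

/-- The midpoint of two points of an affine flow. -/
noncomputable def IsAffineFlow.mid (hL : IsAffineFlow G L) (p : L × L) : L :=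
  ⟨(1 / 2 : ℝ) • (p.1 : E) + (1 / 2 : ℝ) • (p.2 : E),
    hL.convex p.1.2 p.2.2 (by norm_num) (by norm_num) (by norm_num)⟩

theorem IsAffineFlow.continuous_mid (hL : IsAffineFlow G L) : Continuous hL.mid :=
  Continuous.subtype_mk (by fun_prop) _

theorem IsAffineFlow.smul_mid (hL : IsAffineFlow G L) (g : G) (p : L × L) :
    g • hL.mid p = hL.mid (g • p) :=
  Subtype.ext (hL.affine g p.1 p.2 (hL.mid p) _ _ (by norm_num) (by norm_num) (by norm_num) rfl)

/-- If an extension of `P(X)`, `X` minimal, is proximally irreducible, then it is generated by a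
minimal subflow of the closed extreme boundary that lies over the point masses. -/
theorem IsProximallyIrreducibleExtension.exists_minimal (hX : IsMinimalFlow G X)
    (hL : IsAffineFlow G L) (hφ : IsProximallyIrreducibleExtension G φ) :
    ∃ M : Set L, IsSubflow G M ∧ (∀ N, IsSubflow G N → N ⊆ M → N = M) ∧
      (∀ y ∈ M, (y : E) ∈ closure (L.extremePoints ℝ)) ∧ (∀ y ∈ M, φ y ∈ range diracProb) ∧
      closure (convexHull ℝ (Subtype.val '' M)) = L := by
  have := hL.continuousSMul
  have : CompactSpace L := isCompact_iff_compactSpace.1 hL.isCompact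
  have hZ : IsSubflow G {y : L | (y : E) ∈ closure (L.extremePoints ℝ) ∧ φ y ∈ range diracProb} := by
    refine ⟨(isClosed_closure.preimage continuous_subtype_val).inter
      ((isCompact_range continuous_diracProb).isClosed.preimage hφ.continuous), ?_, ?_⟩
    · obtain ⟨x₀⟩ := hX.nonempty
      obtain ⟨e, he⟩ := isCompact_probMeasures.extremePoints_nonempty
        ⟨_, (diracProb x₀).2⟩
      obtain ⟨y, hy, hye⟩ := hφ.toIsAffineExtension.exists_extremePoint hL (y := ⟨e, he.1⟩) he
      obtain ⟨_, ⟨x, rfl⟩, hx⟩ := closure_extremePoints_probMeasures_subset (subset_closure he)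
      exact ⟨y, subset_closure hy, x, hye ▸ Subtype.ext hx⟩
    · rintro g y ⟨hy, x, hx⟩
      refine ⟨hL.smul_mem_closure_extremePoints g hy, g • x, ?_⟩
      rw [hφ.map_smul, ← hx, smul_diracProb]
  obtain ⟨M, hMZ, hM, hmin⟩ := hZ.exists_minimal
  refine ⟨M, hM, hmin, fun y hy => (hMZ hy).1, fun y hy => (hMZ hy).2,
    hφ.eq_of_meets _ (hL.isAffineSubflow_closure_convexHull hM) fun y hy => ?_⟩
  obtain ⟨_, ⟨x, rfl⟩, hx⟩ := closure_extremePoints_probMeasures_subset hy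
  obtain rfl : diracProb x = y := Subtype.ext hx
  -- Minimality of `X` upgrades one point mass in `φ(M)` to all of them.
  have hsub : IsSubflow G {x : X | diracProb x ∈ φ '' M} := by
    refine ⟨(hM.closed.isCompact.image hφ.continuous).isClosed.preimage continuous_diracProb, ?_, ?_⟩
    · obtain ⟨m, hm⟩ := hM.nonempty
      obtain ⟨x, hx⟩ := (hMZ hm).2
      exact ⟨x, m, hm, hx.symm⟩
    · rintro g x ⟨m, hm, hmx⟩
      exact ⟨g • m, hM.smul_mem g m hm, by rw [hφ.map_smul, hmx, smul_diracProb]⟩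
  obtain ⟨m, hm, hmx⟩ := eq_univ_iff_forall.1 (hX.eq_univ hsub) x
  exact ⟨m, subset_closure (subset_convexHull ℝ _ ⟨m, hm, rfl⟩),
    subset_convexHull ℝ _ ⟨(hMZ hm).1, m, hmx, rfl⟩⟩

/-- In a proximally irreducible extension of `P(X)`, two points of the closed extreme boundary in a
fibre over a point mass are proximal. -/
theorem IsProximallyIrreducibleExtension.proximal_of_eq (hX : IsMinimalFlow G X)
    (hL : IsAffineFlow G L) (hφ : IsProximallyIrreducibleExtension G φ) {y₁ y₂ : L}
    (h₁ : (y₁ : E) ∈ closure (L.extremePoints ℝ)) (h₂ : (y₂ : E) ∈ closure (L.extremePoints ℝ))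
    {x : X} (hx₁ : φ y₁ = diracProb x) (hx₂ : φ y₂ = diracProb x) :
    ∃ z, (z, z) ∈ closure (MulAction.orbit G (y₁, y₂)) := by
  have := hL.continuousSMul
  have : CompactSpace L := isCompact_iff_compactSpace.1 hL.isCompact
  set S := closure (MulAction.orbit G (y₁, y₂))
  have hS : IsSubflow G S := isSubflow_closure_orbit _
  have hSe : ∀ p ∈ S, (p.1 : E) ∈ closure (L.extremePoints ℝ) ∧
      (p.2 : E) ∈ closure (L.extremePoints ℝ) := by
    refine closure_minimal (t := {p : L × L | (p.1 : E) ∈ closure (L.extremePoints ℝ) ∧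
      (p.2 : E) ∈ closure (L.extremePoints ℝ)}) ?_
      ((isClosed_closure.preimage (by fun_prop)).inter (isClosed_closure.preimage (by fun_prop)))
    rintro _ ⟨g, rfl⟩
    exact ⟨hL.smul_mem_closure_extremePoints g h₁, hL.smul_mem_closure_extremePoints g h₂⟩
  have hmid : IsSubflow G (hL.mid '' S) := by
    refine ⟨(hS.closed.isCompact.image hL.continuous_mid).isClosed, hS.nonempty.image _, ?_⟩
    rintro g _ ⟨p, hp, rfl⟩
    exact ⟨g • p, hS.smul_mem g p hp, (hL.smul_mid g p).symm⟩
  have hfull : closure (convexHull ℝ (Subtype.val '' (hL.mid '' S))) = L := by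
    refine hφ.eq_of_meets _ (hL.isAffineSubflow_closure_convexHull hmid) fun y hy => ?_
    obtain ⟨_, ⟨x', rfl⟩, hx'⟩ := closure_extremePoints_probMeasures_subset hy
    obtain rfl : diracProb x' = y := Subtype.ext hx'
    -- The pair `(y₁, y₂)` lies over the diagonal point of `x`; by minimality of `X`, `S` contains a
    -- pair over every diagonal point.
    have hsub : IsSubflow G {x' : X | (diracProb x', diracProb x') ∈ Prod.map φ φ '' S} := by
      refine ⟨(hS.closed.isCompact.image (hφ.continuous.prodMap hφ.continuous)).isClosed.preimage
        (continuous_diracProb.prodMk continuous_diracProb),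
        ⟨x, _, mem_closure_orbit_self _, Prod.ext hx₁ hx₂⟩, ?_⟩
      rintro g x' ⟨p, hp, hpx⟩
      refine ⟨g • p, hS.smul_mem g p hp, ?_⟩
      obtain ⟨e₁, e₂⟩ := Prod.ext_iff.1 hpx
      refine Prod.ext ?_ ?_
      · exact (hφ.map_smul g p.1).trans (congrArg (g • ·) e₁)
      · exact (hφ.map_smul g p.2).trans (congrArg (g • ·) e₂)
    obtain ⟨p, hp, hpx⟩ := eq_univ_iff_forall.1 (hX.eq_univ hsub) x'
    obtain ⟨e₁, e₂⟩ := Prod.ext_iff.1 hpx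
    -- A midpoint need not lie in `cl (ext L)`; this is where the convex hull in the definition of
    -- irreducibility is needed.
    refine ⟨hL.mid p, subset_closure (subset_convexHull ℝ _ ⟨_, ⟨p, hp, rfl⟩, rfl⟩), ?_⟩
    have m₁ : (p.1 : E) ∈ closure (L.extremePoints ℝ) ∩
        Subtype.val '' (φ ⁻¹' {diracProb x'}) := ⟨(hSe p hp).1, p.1, e₁, rfl⟩
    have m₂ : (p.2 : E) ∈ closure (L.extremePoints ℝ) ∩
        Subtype.val '' (φ ⁻¹' {diracProb x'}) := ⟨(hSe p hp).2, p.2, e₂, rfl⟩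
    exact convex_convexHull ℝ _ (subset_convexHull ℝ _ m₁) (subset_convexHull ℝ _ m₂)
      (by norm_num) (by norm_num) (by norm_num)
  -- Any extreme point of `L` is the midpoint of some `p ∈ S`, so `p` lies on the diagonal.
  obtain ⟨e, he⟩ := hL.isCompact.extremePoints_nonempty hL.nonempty
  obtain ⟨_, ⟨p, hp, rfl⟩, hpe⟩ := hL.extremePoints_subset hmid.closed hfull he
  have hseg : e ∈ openSegment ℝ (p.1 : E) (p.2 : E) :=
    ⟨1 / 2, 1 / 2, by norm_num, by norm_num, by norm_num, hpe⟩
  obtain ⟨e₁, e₂⟩ := (mem_extremePoints.1 he).2 _ p.1.2 _ p.2.2 hseg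
  refine ⟨p.1, ?_⟩
  have : p.2 = p.1 := Subtype.ext (e₂.trans e₁.symm)
  rwa [show (p.1, p.1) = p from Prod.ext rfl this.symm]

/-- A section over the point masses that generates `L` forces `φ` to be injective. -/
theorem IsAffineExtension.injective_of_section (hL : IsAffineFlow G L)
    (hφ : IsAffineExtension G φ) {ψ : X → L} (hψ : Continuous ψ)
    (hs : ∀ x, φ (ψ x) = diracProb x)
    (hgen : closure (convexHull ℝ (Subtype.val '' range ψ)) = L) : Function.Injective φ := by
  intro a b hab
  by_contra hne
  obtain ⟨ℓ, hℓ⟩ := geometric_hahn_banach_point_point (mt (Subtype.ext (a1 := a) (a2 := b)) hne)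
  -- Integrating `f` against `φ y` recovers `ℓ y`: both are continuous and affine in `y` and agree
  -- on the range of `ψ`. So the separating `ℓ` takes equal values at `a` and `b`.
  let f : C(X, ℝ) := ⟨fun x => ℓ (ψ x), by fun_prop⟩
  have key : ∀ y : L, (φ y).1 f - ℓ y ∈ ({0} : Set ℝ) := by
    intro y
    refine forall_mem_of_mem_closure_convexHull hL.isCompact hL.convex
      (f := fun y : L => (φ y).1 f - ℓ y) (T := {0}) (N := range ψ) ?_ ?_ isClosed_singleton
      (convex_singleton 0) ?_ y (hgen.symm ▸ y.2)
    · exact ((WeakDual.eval_continuous f).comp (continuous_subtype_val.comp hφ.continuous)).sub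
        (ℓ.continuous.comp continuous_subtype_val)
    · intro x y z s t hs ht hst h
      have h' := DFunLike.congr_fun (hφ.affine x y z s t hs ht hst h) f
      have h'' : (φ z).1 f = s * (φ x).1 f + t * (φ y).1 f := h'
      rw [h'', h, map_add, map_smul, map_smul]
      simp only [smul_eq_mul]
      ring
    · rintro _ ⟨x, rfl⟩
      rw [hs, diracProb_apply]
      exact sub_self _
  have ha := sub_eq_zero.1 (key a)
  have hb := sub_eq_zero.1 (key b)
  rw [hab] at ha
  exact hℓ.ne (ha.symm.trans hb)

/-- The affine flow of probability measures on a universal minimal proximal flow is proximally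
irreducible. -/
theorem IsUniversalMinimalProximalFlow.isProximallyIrreducibleFlow
    (hX : IsUniversalMinimalProximalFlow.{u, v, w} G X) :
    IsProximallyIrreducibleFlow.{u, v, w} G (probMeasures X) := by
  have := hX.minimal.nonempty
  refine ⟨isAffineFlow_probMeasures G, ?_⟩
  intro E _ _ _ _ _ _ _ L _ hL φ hφ
  have := hL.continuousSMul
  have : CompactSpace L := isCompact_iff_compactSpace.1 hL.isCompact
  obtain ⟨M, hM, hmin, hMe, hMδ, hgen⟩ := hφ.exists_minimal hX.minimal hL
  have hprox : ∀ y₁ ∈ M, ∀ y₂ ∈ M, ∃ z, (z, z) ∈ closure (MulAction.orbit G (y₁, y₂)) := by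
    intro y₁ h₁ y₂ h₂
    have hS : IsSubflow G (closure (MulAction.orbit G (y₁, y₂))) := isSubflow_closure_orbit _
    have hSM : closure (MulAction.orbit G (y₁, y₂)) ⊆ M ×ˢ M := by
      refine closure_minimal ?_ (hM.closed.prod hM.closed)
      rintro _ ⟨g, rfl⟩
      exact ⟨hM.smul_mem g _ h₁, hM.smul_mem g _ h₂⟩
    obtain ⟨x₁, hx₁⟩ := hMδ y₁ h₁
    obtain ⟨x₂, hx₂⟩ := hMδ y₂ h₂
    -- Proximality in `X` is lifted: by compactness the orbit closure of `(y₁, y₂)` contains a pair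
    -- `p` over `(δ_x, δ_x)`, to which `proximal_of_eq` applies.
    obtain ⟨F, x, hF, hFx⟩ := hX.proximal x₁ x₂
    have hx := exists_tendsto_iff_mem_closure_orbit.1 ⟨F, hF, hFx⟩
    have hcl : IsClosed (Prod.map φ φ '' closure (MulAction.orbit G (y₁, y₂))) :=
      (hS.closed.isCompact.image (hφ.continuous.prodMap hφ.continuous)).isClosed
    have hmem := map_mem_closure (continuous_diracProb.prodMap continuous_diracProb) hx
      (t := Prod.map φ φ '' closure (MulAction.orbit G (y₁, y₂))) (by
        rintro _ ⟨g, rfl⟩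
        refine ⟨g • (y₁, y₂), subset_closure ⟨g, rfl⟩, Prod.ext ?_ ?_⟩
        · exact (hφ.map_smul g y₁).trans (congrArg (g • ·) hx₁.symm)
        · exact (hφ.map_smul g y₂).trans (congrArg (g • ·) hx₂.symm))
    rw [hcl.closure_eq] at hmem
    obtain ⟨p, hp, hpx⟩ := hmem
    obtain ⟨e₁, e₂⟩ := Prod.ext_iff.1 hpx
    obtain ⟨z, hz⟩ := hφ.proximal_of_eq hX.minimal hL (hMe p.1 (hSM hp).1) (hMe p.2 (hSM hp).2)
      e₁ e₂
    exact ⟨z, hS.closure_orbit_subset hp hz⟩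
  let _ : MulAction G M := hM.mulAction
  have : ContinuousSMul G M := hM.continuousSMul
  have : CompactSpace M := isCompact_iff_compactSpace.1 hM.closed.isCompact
  obtain ⟨ψ, hψ⟩ := hX.universal M (hM.isMinimalFlow hmin) (hM.isProximalFlow hprox)
  have hψc : Continuous fun x => (ψ x : L) := continuous_subtype_val.comp hψ.continuous
  -- Universality provides some `ψ` with no control over `φ ∘ ψ`; rigidity makes it a section over
  -- the point masses.
  have hs : (fun x => φ (ψ x)) = diracProb := by
    refine hX.minimal.eq_of_proximal hX.proximal continuous_diracProb
      (fun g x => (smul_diracProb g x).symm) (hφ.continuous.comp hψc) (fun g x => ?_)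
      (fun x => hMδ _ (ψ x).2)
    rw [hψ.map_smul]
    exact hφ.map_smul g _
  have hran : range (fun x => (ψ x : L)) = M := by
    rw [← Function.comp_def, range_comp, hψ.surjective.range_eq, image_univ, Subtype.range_coe]
  have hinj := hφ.toIsAffineExtension.injective_of_section hL hψc (congrFun hs)
    (by rw [hran, hgen])
  exact isHomeomorph_iff_continuous_bijective.2 ⟨hφ.continuous, hinj, hφ.surjective⟩

end Irreducible

/-- For a Polish group `G`, the affine flow `P(Π(G))` of regular Borel probability measures on the
universal minimal proximal flow `Π(G)` is proximally irreducible. -/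
theorem mainTheorem11 (G : Type u) [Group G] [TopologicalSpace G] [IsTopologicalGroup G]
    [PolishSpace G] :
    IsProximallyIrreducibleFlow.{u, u, w} G (probMeasures (UMPF G)) :=
  UMPF.isUniversal.isProximallyIrreducibleFlow
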